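/- An \emph{effect algebra} is a partial algebra $(E;\oplus,0,1)$ with a partial binary operation $\oplus$ and constants $0,1$ such that: (E1) if $a\oplus b$ is defined, then $b\oplus a$ is defined and $a\oplus b=b\oplus a$; (E2) if $a\oplus b$ and $(a\oplus b)\oplus c$ are defined, then $b\oplus c$ and $a\oplus(b\oplus c)$ are defined and $(a\oplus b)\oplus c=a\oplus(b\oplus c)$; (E3) for every $a\in E$ there is a unique $a'\in E$ with $a\oplus a'=1$; (E4) if $a\oplus 1$ is defined, then $a=0$. Write $a\perp b$ if $a\oplus b$ is defined, and $a\le b$ if $a\oplus c=b$ for some $c\in E$; this is a partial order on $E$. An effect algebra $E$ is - an \emph{orthoalgebra} if $a\perp a$ implies $a=0$ for all $a\in E$; - \emph{lattice-ordered} if any two elements of $(E,\le)$ have a supremum and an infimum; - said to have the \emph{Riesz decomposition property} if, for all $n$ and all $u,v_1,\dots,v_n\in E$ such that $v_1\oplus\dots\oplus v_n$ exists and $u\le v_1\oplus\dots\oplus v_n$, there are $u_1,\dots,u_n\in E$ with $u_i\le v_i$ for $1\le i\le n$ and $u=u_1\oplus\dots\oplus u_n$ (the empty sum being $0$); - \emph{homogeneous}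 if, for all $u,v_1,v_2\in E$ such that $v_1\perp v_2$, $u\le v_1\oplus v_2$ and $u\le (v_1\oplus v_2)'$, there are $u_1,u_2\in E$ with $u_1\le v_1$, $u_2\le v_2$ and $u=u_1\oplus u_2$. **Proposition.** (a) Every orthoalgebra is homogeneous. (b) Every effect algebra with the Riesz decomposition property is homogeneous. (c) Every lattice-ordered effect algebra is homogeneous. -/

import Mathlib

/-- An effect algebra: a partial algebra `(E; ⊕, 0, 1)`.  The partial operation is modelled by an
`Option`-valued map: `oplus a b = some c` says that `a ⊕ b` is defined and equal to `c`, and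
`oplus a b = none` says that `a ⊕ b` is undefined. -/
class EffectAlgebra (E : Type*) extends Zero E, One E where
  oplus : E → E → Option E
  oplus_comm : ∀ a b c : E, oplus a b = some c → oplus b a = some c
  oplus_assoc : ∀ a b c d e : E, oplus a b = some d → oplus d c = some e →
    ∃ f, oplus b c = some f ∧ oplus a f = some e
  existsUnique_orthosupplement : ∀ a : E, ∃! b : E, oplus a b = some 1
  eq_zero_of_oplus_one : ∀ a b : E, oplus a 1 = some b → a = 0

namespace EffectAlgebra

section Basic

variable {E : Type*} [EffectAlgebra E]

/-- The orthosupplement `a'`, the unique element with `a ⊕ a' = 1`. -/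
noncomputable def orthosupplement (a : E) : E :=
  (existsUnique_orthosupplement a).choose

theorem oplus_orthosupplement (a : E) : oplus a (orthosupplement a) = some 1 :=
  (existsUnique_orthosupplement a).choose_spec.1

theorem oplus_zero (a : E) : oplus a 0 = some a := by
  have h1 : oplus (1 : E) 0 = some 1 := by
    have h := oplus_orthosupplement (1 : E)
    have h0 := eq_zero_of_oplus_one _ _ (oplus_comm _ _ _ h)
    rwa [h0] at h
  have ha := oplus_comm _ _ _ (oplus_orthosupplement a)
  obtain ⟨f, hf, hf'⟩ := oplus_assoc _ _ _ _ _ ha h1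
  rw [hf, (existsUnique_orthosupplement (orthosupplement a)).unique hf' ha]

theorem oplus_left_cancel {a b c d : E} (hb : oplus a b = some d) (hc : oplus a c = some d) :
    b = c := by
  have hd := oplus_orthosupplement d
  obtain ⟨f, hf, hbf⟩ := oplus_assoc _ _ _ _ _ (oplus_comm _ _ _ hb) hd
  obtain ⟨g, hg, hcg⟩ := oplus_assoc _ _ _ _ _ (oplus_comm _ _ _ hc) hd
  obtain rfl : f = g := Option.some.inj (hf.symm.trans hg)
  exact (existsUnique_orthosupplement f).unique (oplus_comm _ _ _ hbf) (oplus_comm _ _ _ hcg)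

theorem eq_zero_of_oplus_eq_zero {a b : E} (h : oplus a b = some 0) : b = 0 := by
  obtain ⟨f, hf, -⟩ := oplus_assoc _ _ _ _ _ h (oplus_comm _ _ _ (oplus_zero (1 : E)))
  exact eq_zero_of_oplus_one _ _ hf

/-- The order of an effect algebra: `a ≤ b` iff there is `c` with `a ⊕ c = b`. -/
instance : PartialOrder E where
  le a b := ∃ c, oplus a c = some b
  le_refl a := ⟨0, oplus_zero a⟩
  le_trans := by
    rintro a b c ⟨x, hx⟩ ⟨y, hy⟩
    obtain ⟨f, -, hf⟩ := oplus_assoc _ _ _ _ _ hx hy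
    exact ⟨f, hf⟩
  le_antisymm := by
    rintro a b ⟨x, hx⟩ ⟨y, hy⟩
    obtain ⟨f, hf, haf⟩ := oplus_assoc _ _ _ _ _ hx hy
    obtain rfl : f = 0 := oplus_left_cancel haf (oplus_zero a)
    obtain rfl : x = 0 := eq_zero_of_oplus_eq_zero (oplus_comm _ _ _ hf)
    exact Option.some.inj ((oplus_zero a).symm.trans hx)

theorem le_iff {a b : E} : a ≤ b ↔ ∃ c, oplus a c = some b := Iff.rfl

/-- The orthosum of a finite list, `c₁ ⊕ (c₂ ⊕ (⋯ ⊕ (cₙ ⊕ 0)))`; it is `some s` if the sum exists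
and equals `s`, and `none` if it does not exist.  The empty sum is `0`, and by associativity the
bracketing is immaterial. -/
def listSum : List E → Option E
  | [] => some 0
  | a :: l => (listSum l).bind fun s => oplus a s

/-- The orthosum `v₁ ⊕ ⋯ ⊕ vₙ` of a finite family. -/
def finSum {n : ℕ} (v : Fin n → E) : Option E := listSum (List.ofFn v)

end Basic

/-- `a ⟂ b`: the sum `a ⊕ b` is defined. -/
def Orthogonal {E : Type*} [EffectAlgebra E] (a b : E) : Prop := ∃ c, oplus a b = some c

/-- An orthoalgebra: an effect algebra in which `a ⟂ a` implies `a = 0`. -/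
def IsOrthoalgebra (E : Type*) [EffectAlgebra E] : Prop :=
  ∀ a : E, Orthogonal a a → a = 0

/-- The Riesz decomposition property. -/
def RieszDecomposition (E : Type*) [EffectAlgebra E] : Prop :=
  ∀ (n : ℕ) (v : Fin n → E) (u s : E), finSum v = some s → u ≤ s →
    ∃ w : Fin n → E, (∀ i, w i ≤ v i) ∧ finSum w = some u

/-- Lattice ordered: any two elements have a supremum and an infimum. -/
def IsLatticeOrdered (E : Type*) [EffectAlgebra E] : Prop :=
  ∀ a b : E, (∃ s, IsLUB {a, b} s) ∧ ∃ i, IsGLB {a, b} i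

/-- Homogeneous: if `v₁ ⊕ v₂` is defined, `u ≤ v₁ ⊕ v₂` and `u ≤ (v₁ ⊕ v₂)'`, then
`u = u₁ ⊕ u₂` for some `u₁ ≤ v₁` and `u₂ ≤ v₂`. -/
def IsHomogeneous (E : Type*) [EffectAlgebra E] : Prop :=
  ∀ u v₁ v₂ s : E, oplus v₁ v₂ = some s → u ≤ s → u ≤ orthosupplement s →
    ∃ u₁ u₂ : E, u₁ ≤ v₁ ∧ u₂ ≤ v₂ ∧ oplus u₁ u₂ = some u

end EffectAlgebra

/-! Let `s = v₁ ⊕ v₂`. The bound `u ≤ s'` makes `u` orthogonal to everything below `s`. In an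
orthoalgebra this forces `u = 0`, as `u ≤ s`; the Riesz property at `n = 2` gives the splitting
directly. In the lattice case `u ⊕ v₁` exists, and both it and `s` bound `u ∨ v₁` from above;
`oplus_eq_of_oplus_oplus_eq` then cancels across the chains `v₁ ≤ u ∨ v₁ ≤ u ⊕ v₁` and `v₁ ≤ u ∨ v₁
≤ s`. -/

namespace EffectAlgebra

section Homogeneity

variable {E : Type*} [EffectAlgebra E]

/-- Orthogonality passes to smaller elements on the right. -/
theorem Orthogonal.mono_right {a b c : E} (h : Orthogonal a c) (hbc : b ≤ c) :
    Orthogonal a b := by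
  obtain ⟨d, hd⟩ := h
  obtain ⟨x, hx⟩ := hbc
  obtain ⟨g, hg, -⟩ := oplus_assoc _ _ _ _ _ (oplus_comm _ _ _ hx) (oplus_comm _ _ _ hd)
  exact ⟨g, oplus_comm _ _ _ hg⟩

theorem orthogonal_of_le_orthosupplement {a b : E} (h : b ≤ orthosupplement a) :
    Orthogonal a b :=
  Orthogonal.mono_right ⟨1, oplus_orthosupplement a⟩ h

theorem Orthogonal.symm {a b : E} (h : Orthogonal a b) : Orthogonal b a :=
  h.imp fun _ hc => oplus_comm _ _ _ hc

/-- If `a ⊕ b = c` and `c ⊕ d = a ⊕ e`, then `b ⊕ d = e`. -/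
theorem oplus_eq_of_oplus_oplus_eq {a b c d e s : E} (h : oplus a b = some c)
    (hs : oplus c d = some s) (hs' : oplus a e = some s) : oplus b d = some e := by
  obtain ⟨f, hf, haf⟩ := oplus_assoc _ _ _ _ _ h hs
  rwa [oplus_left_cancel haf hs'] at hf

theorem finSum_two (v : Fin 2 → E) : finSum v = oplus (v 0) (v 1) := by
  simp [finSum, listSum, oplus_zero]

theorem IsOrthoalgebra.isHomogeneous (hE : IsOrthoalgebra E) : IsHomogeneous E := by
  intro u v₁ v₂ s _ hus hus'
  have hu : Orthogonal u u :=
    ((orthogonal_of_le_orthosupplement hus').symm).mono_right hus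
  obtain rfl := hE u hu
  have zero_le (a : E) : 0 ≤ a := ⟨a, oplus_comm _ _ _ (oplus_zero a)⟩
  exact ⟨0, 0, zero_le v₁, zero_le v₂, oplus_zero 0⟩

theorem RieszDecomposition.isHomogeneous (hE : RieszDecomposition E) : IsHomogeneous E := by
  intro u v₁ v₂ s hs hus _
  obtain ⟨w, hw, hwu⟩ := hE 2 ![v₁, v₂] u s ((finSum_two _).trans hs) hus
  exact ⟨w 0, w 1, hw 0, hw 1, (finSum_two w).symm.trans hwu⟩

/-- Writing `j` for the supremum of `u` and `v₁`, the summands of `u` are `(u ⊕ v₁) ⊖ j` and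
`j ⊖ v₁`. -/
theorem IsLatticeOrdered.isHomogeneous (hE : IsLatticeOrdered E) : IsHomogeneous E := by
  intro u v₁ v₂ s hs hus hus'
  -- `u ⟂ s` and `v₁ ≤ s`.
  obtain ⟨t, ht⟩ : Orthogonal u v₁ :=
    ((orthogonal_of_le_orthosupplement hus').symm).mono_right ⟨v₂, hs⟩
  have ht' := oplus_comm _ _ _ ht
  obtain ⟨j, hj⟩ := (hE u v₁).1
  have hle {b : E} (hu : u ≤ b) (hv : v₁ ≤ b) : j ≤ b := hj.2 (by simp [hu, hv])
  obtain ⟨x, hx⟩ : u ≤ j := hj.1 (by simp)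
  obtain ⟨y, hy⟩ : v₁ ≤ j := hj.1 (by simp)
  obtain ⟨m, hm⟩ : j ≤ t := hle ⟨v₁, ht⟩ ⟨u, ht'⟩
  obtain ⟨z, hz⟩ : j ≤ s := hle hus ⟨v₂, hs⟩
  -- Cancelling `u` from `u ⊕ x ⊕ m = t` gives `x ⊕ m = v₁`; cancelling `v₁` from `v₁ ⊕ y ⊕ z = s`
  -- and `v₁ ⊕ y ⊕ m = t` gives `y ⊕ z = v₂` and `y ⊕ m = u`.
  exact ⟨m, y, ⟨x, oplus_comm _ _ _ (oplus_eq_of_oplus_oplus_eq hx hm ht)⟩,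
    ⟨z, oplus_eq_of_oplus_oplus_eq hy hz hs⟩,
    oplus_comm _ _ _ (oplus_eq_of_oplus_oplus_eq hy hm ht')⟩

end Homogeneity

end EffectAlgebra

theorem mainTheorem6 (E : Type*) [EffectAlgebra E] :
    (EffectAlgebra.IsOrthoalgebra E → EffectAlgebra.IsHomogeneous E) ∧
    (EffectAlgebra.RieszDecomposition E → EffectAlgebra.IsHomogeneous E) ∧
    (EffectAlgebra.IsLatticeOrdered E → EffectAlgebra.IsHomogeneous E) :=
  ⟨EffectAlgebra.IsOrthoalgebra.isHomogeneous, EffectAlgebra.RieszDecomposition.isHomogeneous,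
    EffectAlgebra.IsLatticeOrdered.isHomogeneous⟩
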